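/- Let $M$ be a smooth ($C^\infty$, real, finite-dimensional, Hausdorff, paracompact) manifold, let $(L,\langle\cdot,\cdot\rangle)$ be a smooth hermitian complex line bundle over $M$, and let $\nabla$ be a hermitian connexion on $L$, i.e. a linear map $\nabla:\Gamma(L)\to\Omega^1(M;\mathbb C)\otimes\Gamma(L)$ with $\nabla(fs)=df\otimes s+f\nabla s$ and $X\langle r,s\rangle=\langle\nabla_X r,s\rangle+\langle r,\nabla_X s\rangle$ for all $r,s\in\Gamma(L)$, $f\in C^\infty(M;\mathbb C)$ and all real vector fields $X$. Let $e\neq 0$ be a real constant and $\omega\in\Omega^2(M;\mathbb R)$ a smooth real $2$-form such that the curvature of $\nabla$ is $\frac{i}{e}\omega$, i.e. $$\tfrac{i}{e}\,\omega(X,Y)\,s=\nabla_X\nabla_Y s-\nabla_Y\nabla_X s-\nabla_{[X,Y]}s$$ for all smooth vector fields $X,Y$ and all $s\in\Gamma(L)$. Then $\frac1e\omega$ is closed, and its de Rham class $[\frac1e\omega]\in H^2_{dR}(M;\mathbb R)$ is integral: under the de Rham isomorphism $H^2_{dR}(M;\mathbb R)\cong\check H^2(M;\mathbb R)$ it lies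 in the image of the homomorphism $\check H^2(M;\mathbb Z)\to\check H^2(M;\mathbb R)$ induced by $\mathbb Z\ni k\mapsto 2\pi k\in\mathbb R$. Here the de Rham isomorphism sends the class of a closed $2$-form $\eta$ to the Čech class of $a_{jkl}=f_{jk}+f_{kl}-f_{jl}$, where, on a sufficiently fine open cover $\{A_j\}$ of $M$, $\eta=d\theta_j$ on $A_j$ and $\theta_j-\theta_k=df_{jk}$ on $A_j\cap A_k$. -/

import Mathlib

open scoped Manifold ContDiff

/-! ### Differential forms on a manifold -/

section Forms

variable (n : ℕ) (M : Type*) [TopologicalSpace M] [ChartedSpace (EuclideanSpace ℝ (Fin n)) M]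

/-- A (not necessarily smooth) differential `k`-form on `M` with values in `F`. -/
abbrev DiffForm (k : ℕ) (F : Type*) [NormedAddCommGroup F] [NormedSpace ℝ F] : Type _ :=
  (x : M) → TangentSpace (𝓡 n) x [⋀^Fin k]→L[ℝ] F

end Forms

namespace DiffForm

variable {n : ℕ} {M : Type*} [TopologicalSpace M] [ChartedSpace (EuclideanSpace ℝ (Fin n)) M]
  {k : ℕ}

/-- The expression of a form in the preferred chart at `c`: its pullback under the inverse of the
chart, a form on (the target of the chart in) `ℝⁿ`. -/
noncomputable def inChart (w : DiffForm n M k ℝ) (c : M) :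
    EuclideanSpace ℝ (Fin n) → EuclideanSpace ℝ (Fin n) [⋀^Fin k]→L[ℝ] ℝ :=
  fun y => (w ((extChartAt (𝓡 n) c).symm y)).compContinuousLinearMap
    (mfderiv 𝓘(ℝ, EuclideanSpace ℝ (Fin n)) (𝓡 n) (extChartAt (𝓡 n) c).symm y)

/-- Smoothness of a form on a subset `U` of `M`, which will be open: all its chart expressions
are smooth. -/
def SmoothOn (w : DiffForm n M k ℝ) (U : Set M) : Prop :=
  ∀ c : M, ContDiffOn ℝ ∞ (w.inChart c)
    ((extChartAt (𝓡 n) c).target ∩ (extChartAt (𝓡 n) c).symm ⁻¹' U)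

/-- The exterior derivative: at `x`, compute `d` of the expression in the chart at `x` and pull
the result back by the chart. -/
noncomputable def d (w : DiffForm n M k ℝ) : DiffForm n M (k + 1) ℝ :=
  fun x => (extDeriv (w.inChart x) (extChartAt (𝓡 n) x x)).compContinuousLinearMap
    (mfderiv (𝓡 n) 𝓘(ℝ, EuclideanSpace ℝ (Fin n)) (extChartAt (𝓡 n) x) x)

lemma inChart_add (w η : DiffForm n M k ℝ) (c : M) :
    inChart (n := n) (w + η) c = inChart w c + inChart η c := rfl

lemma inChart_smul (a : ℝ) (w : DiffForm n M k ℝ) (c : M) :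
    inChart (n := n) (a • w) c = a • inChart w c := rfl

lemma inChart_zero (c : M) : inChart (0 : DiffForm n M k ℝ) c = 0 := rfl

lemma SmoothOn.differentiableAt {w : DiffForm n M k ℝ} (h : SmoothOn w Set.univ) (x : M) :
    DifferentiableAt ℝ (w.inChart x) (extChartAt (𝓡 n) x x) := by
  have h1 := h x
  rw [Set.preimage_univ, Set.inter_univ] at h1
  exact (h1.contDiffAt (extChartAt_target_mem_nhds x)).differentiableAt (by simp)

lemma d_add {w η : DiffForm n M k ℝ} (hw : SmoothOn w Set.univ) (hη : SmoothOn η Set.univ) :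
    d (n := n) (w + η) = d w + d η := by
  funext x
  simp only [d, inChart_add, Pi.add_apply]
  rw [extDeriv_add (hw.differentiableAt x) (hη.differentiableAt x)]
  rfl

lemma d_smul (a : ℝ) (w : DiffForm n M k ℝ) : d (n := n) (a • w) = a • d w := by
  funext x
  simp only [d, inChart_smul, Pi.smul_apply]
  rw [extDeriv_smul]
  rfl

lemma d_zero : d (0 : DiffForm n M k ℝ) = 0 := by
  have := d_smul (0 : ℝ) (0 : DiffForm n M k ℝ)
  simpa using this

variable (n M k)

/-- The space `Ω^k(M; ℝ)` of smooth real `k`-forms. -/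
def smoothForms : Submodule ℝ (DiffForm n M k ℝ) where
  carrier := {w | SmoothOn w Set.univ}
  add_mem' hw hη c := (hw c).add (hη c)
  zero_mem' _ := contDiffOn_const (c := (0 : EuclideanSpace ℝ (Fin n) [⋀^Fin k]→L[ℝ] ℝ))
  smul_mem' a _ hw c := (hw c).const_smul a

variable {n M k} in
lemma mem_smoothForms {w : DiffForm n M k ℝ} : w ∈ smoothForms n M k ↔ SmoothOn w Set.univ := Iff.rfl

/-- The space of closed smooth `k`-forms. -/
def closedForms : Submodule ℝ (DiffForm n M k ℝ) where
  carrier := {w | w ∈ smoothForms n M k ∧ d w = 0}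
  add_mem' hw hη := ⟨add_mem hw.1 hη.1, by rw [d_add (mem_smoothForms.1 hw.1) (mem_smoothForms.1 hη.1), hw.2, hη.2, add_zero]⟩
  zero_mem' := ⟨zero_mem _, d_zero⟩
  smul_mem' a _ hw := ⟨Submodule.smul_mem _ a hw.1, by rw [d_smul, hw.2, smul_zero]⟩

/-- The space of exact `(k+1)`-forms: exterior derivatives of smooth `k`-forms. -/
def exactForms : Submodule ℝ (DiffForm n M (k + 1) ℝ) where
  carrier := {w | ∃ θ ∈ smoothForms n M k, d θ = w}
  add_mem' := by
    rintro _ _ ⟨θ, hθ, rfl⟩ ⟨η, hη, rfl⟩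
    exact ⟨θ + η, add_mem hθ hη, d_add (mem_smoothForms.1 hθ) (mem_smoothForms.1 hη)⟩
  zero_mem' := ⟨0, zero_mem _, d_zero⟩
  smul_mem' := by
    rintro a _ ⟨θ, hθ, rfl⟩
    exact ⟨a • θ, Submodule.smul_mem _ a hθ, d_smul a θ⟩

/-- The second de Rham cohomology space `H²_dR(M; ℝ)`: closed forms modulo exact forms. -/
abbrev DeRhamH2 : Type _ :=
  closedForms n M 2 ⧸ (exactForms n M 1).comap (closedForms n M 2).subtype

variable {n M}

/-- The de Rham class of a closed `2`-form. -/
noncomputable def deRhamClass (w : closedForms n M 2) : DeRhamH2 n M := Submodule.Quotient.mk w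

end DiffForm

/-! ### Čech cohomology with constant coefficients

Open covers are indexed by the points of the space, the member with index `x` containing `x`. Every
open cover is refined by such a cover, and between two of them, one finer than the other index by
index, the refinement map is the identity of the index set. So Čech cohomology is the direct limit
over these covers. -/

/-- An open cover `(U x)` indexed by the points `x` of `M`, with `x ∈ U x`. -/
structure PointedCover (M : Type*) [TopologicalSpace M] where
  /-- the member of the cover with index `x` -/
  toFun : M → Set M
  isOpen : ∀ x, IsOpen (toFun x)
  mem : ∀ x, x ∈ toFun x

namespace PointedCover

variable {M : Type*} [TopologicalSpace M]

instance : CoeFun (PointedCover M) (fun _ => M → Set M) := ⟨toFun⟩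

/-- `U ≤ V` means that `V` is finer than `U`. -/
instance : Preorder (PointedCover M) where
  le U V := ∀ x, V x ⊆ U x
  le_refl _ _ := subset_rfl
  le_trans _ _ _ h₁ h₂ x := (h₂ x).trans (h₁ x)

/-- The intersection of the members of a cover with indices `s 0, …, s (m - 1)`. -/
def inter (U : PointedCover M) {m : ℕ} (s : Fin m → M) : Set M := ⋂ i, U (s i)

lemma inter_anti {U V : PointedCover M} (h : U ≤ V) {m : ℕ} (s : Fin m → M) :
    V.inter s ⊆ U.inter s := Set.iInter_mono fun i => h (s i)

lemma inter_comp (U : PointedCover M) {l m : ℕ} (s : Fin m → M) (r : Fin l → Fin m) :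
    U.inter s ⊆ U.inter (s ∘ r) := Set.subset_iInter fun i => Set.iInter_subset _ (r i)

end PointedCover

namespace Cech

variable {M : Type*} [TopologicalSpace M]

/-- Restriction of locally constant functions to a smaller set. -/
def restrict {A : Type*} [AddCommGroup A] {S T : Set M} (h : S ⊆ T) :
    LocallyConstant T A →+ LocallyConstant S A :=
  LocallyConstant.comapAddMonoidHom ⟨Set.inclusion h, continuous_inclusion h⟩

/-- Čech `p`-cochains of a cover with coefficients in the constant sheaf `A`: to indices
`s 0, …, s p` they attach a section of the constant sheaf, i.e. a locally constant function, over
`U (s 0) ∩ … ∩ U (s p)`. -/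
abbrev Cochain (U : PointedCover M) (A : Type*) (p : ℕ) : Type _ :=
  (s : Fin (p + 1) → M) → LocallyConstant (U.inter s) A

variable {A B : Type*} [AddCommGroup A] [AddCommGroup B]

/-- The Čech differential
`(δ a) (s 0, …, s (p+1)) = ∑ i, (-1)^i a (s 0, …, omit s i, …, s (p+1))`. -/
def delta (U : PointedCover M) (A : Type*) [AddCommGroup A] (p : ℕ) :
    Cochain U A p →+ Cochain U A (p + 1) where
  toFun a s := ∑ i : Fin (p + 2),
    (-1 : ℤ) ^ (i : ℕ) • restrict (U.inter_comp s i.succAbove) (a (s ∘ i.succAbove))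
  map_zero' := by funext s; simp
  map_add' a b := by funext s; simp [Finset.sum_add_distrib]

/-- Restriction of cochains to a finer cover. -/
def refine {U V : PointedCover M} (h : U ≤ V) (p : ℕ) : Cochain U A p →+ Cochain V A p where
  toFun a s := restrict (PointedCover.inter_anti h s) (a s)
  map_zero' := by funext s; simp
  map_add' a b := by funext s; simp

/-- The change of coefficients on cochains induced by a homomorphism. -/
def mapCoeff (φ : A →+ B) (U : PointedCover M) (p : ℕ) : Cochain U A p →+ Cochain U B p where
  toFun a s := LocallyConstant.mapAddMonoidHom φ (a s)
  map_zero' := by funext s; exact map_zero _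
  map_add' a b := by funext s; exact map_add _ _ _

lemma delta_refine {U V : PointedCover M} (h : U ≤ V) (p : ℕ) (a : Cochain U A p) :
    delta V A p (refine h p a) = refine h (p + 1) (delta U A p a) := by
  funext s
  simp only [delta, refine, AddMonoidHom.coe_mk, ZeroHom.coe_mk, map_sum, map_zsmul]
  rfl

lemma delta_mapCoeff (φ : A →+ B) (U : PointedCover M) (p : ℕ) (a : Cochain U A p) :
    delta U B p (mapCoeff φ U p a) = mapCoeff φ U (p + 1) (delta U A p a) := by
  funext s
  simp only [delta, mapCoeff, AddMonoidHom.coe_mk, ZeroHom.coe_mk, map_sum, map_zsmul]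
  rfl

variable (A) in
/-- Čech `2`-cocycles of a cover. -/
abbrev Cocycle (U : PointedCover M) : AddSubgroup (Cochain U A 2) := (delta U A 2).ker

variable (A) in
/-- `H²(U; A)`: cocycles modulo coboundaries. -/
abbrev CoverH2 (U : PointedCover M) : Type _ :=
  Cocycle A U ⧸ (delta U A 1).range.addSubgroupOf (Cocycle A U)

/-- A homomorphism of cochain groups that commutes with the differentials acts on cocycles. -/
def cocycleMap {U V : PointedCover M} (F : ∀ p, Cochain U A p →+ Cochain V B p)
    (hF : ∀ p a, delta V B p (F p a) = F (p + 1) (delta U A p a)) : Cocycle A U →+ Cocycle B V :=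
  ((F 2).comp (Cocycle A U).subtype).codRestrict (Cocycle B V) (fun a => by
    have ha : delta U A 2 a = 0 := a.2
    change delta V B 2 (F 2 a) = 0
    rw [hF, ha, map_zero])

/-- The homomorphism that a cochain map induces in the second cohomology. -/
def coverMap {U V : PointedCover M} (F : ∀ p, Cochain U A p →+ Cochain V B p)
    (hF : ∀ p a, delta V B p (F p a) = F (p + 1) (delta U A p a)) : CoverH2 A U →+ CoverH2 B V :=
  QuotientAddGroup.map _ _ (cocycleMap F hF) (by
    rintro ⟨_, h⟩ ⟨b, rfl⟩
    exact ⟨F 1 b, hF 1 b⟩)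

variable (A) in
/-- The homomorphism `H²(U; A) → H²(V; A)` for a cover `V` finer than `U`. -/
def coverRefine (U V : PointedCover M) (h : U ≤ V) : CoverH2 A U →+ CoverH2 A V :=
  coverMap (refine h) (delta_refine h)

open scoped Classical in
variable (M A) in
/-- The second Čech cohomology group `Ȟ²(M; A)` with coefficients in the constant sheaf `A`. -/
abbrev H2 : Type _ := AddCommGroup.DirectLimit (fun U : PointedCover M => CoverH2 A U) (coverRefine A)

open scoped Classical in
/-- The class in `Ȟ²(M; A)` of a `2`-cocycle of a cover. -/
noncomputable def classOf {U : PointedCover M} (a : Cocycle A U) : H2 M A :=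
  AddCommGroup.DirectLimit.of (fun U : PointedCover M => CoverH2 A U) (coverRefine A) U
    (QuotientAddGroup.mk a)

open scoped Classical in
variable (M) in
/-- The homomorphism `Ȟ²(M; A) → Ȟ²(M; B)` induced by a homomorphism `A → B`. -/
noncomputable def H2map (φ : A →+ B) : H2 M A →+ H2 M B :=
  AddCommGroup.DirectLimit.map (fun U => coverMap (mapCoeff φ U) (delta_mapCoeff φ U))
    (fun U V h => by
      ext a
      rfl)

/-- Change of coefficients is computed on cocycles. -/
lemma H2map_classOf (φ : A →+ B) {U : PointedCover M} (a : Cocycle A U) :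
    H2map M φ (classOf a) = classOf (cocycleMap (mapCoeff φ U) (delta_mapCoeff φ U) a) := by
  classical
  exact AddCommGroup.DirectLimit.map_apply_of _ _ _

end Cech

/-! ### The comparison of de Rham and Čech cohomology, and integral classes -/

section Integral

variable {n : ℕ} {M : Type*} [TopologicalSpace M] [ChartedSpace (EuclideanSpace ℝ (Fin n)) M]

/-- The graph of the de Rham isomorphism `H²_dR(M; ℝ) ≅ Ȟ²(M; ℝ)`, at the level of closed forms:
the form `η` is sent to the class of the cocycle `a` on the cover `U` if there are
* smooth `1`-forms `θ x` on `U x` with `d (θ x) = η`, and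
* smooth functions `f x y` on `U x ∩ U y` with `d (f x y) = θ x - θ y`, such that
* `f x y + f y z - f x z = a x y z` on `U x ∩ U y ∩ U z`. -/
def DeRhamCechRel (η : DiffForm.closedForms n M 2) (c : Cech.H2 M ℝ) : Prop :=
  ∃ (U : PointedCover M) (θ : M → DiffForm n M 1 ℝ) (f : M → M → M → ℝ) (a : Cech.Cocycle ℝ U),
    (∀ x, (θ x).SmoothOn (U x) ∧ ∀ p ∈ U x, (θ x).d p = η.1 p) ∧
    (∀ x y, ContMDiffOn (𝓡 n) 𝓘(ℝ, ℝ) ∞ (f x y) (U x ∩ U y) ∧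
      ∀ p ∈ U x ∩ U y, ∀ v : TangentSpace (𝓡 n) p,
        mvfderiv (𝓡 n) (f x y) p v = θ x p ![v] - θ y p ![v]) ∧
    (∀ x y z, ∀ p : U.inter ![x, y, z],
      a.1 ![x, y, z] p = f x y p + f y z p - f x z p) ∧
    Cech.classOf a = c

/-- The homomorphism `ℤ → ℝ`, `k ↦ 2πk`. -/
noncomputable def twoPiZ : ℤ →+ ℝ :=
  (AddMonoidHom.mulLeft (2 * Real.pi)).comp (Int.castAddHom ℝ)

/-- A de Rham class is integral if its image under the de Rham isomorphism
`H²_dR(M; ℝ) ≅ Ȟ²(M; ℝ)` is in the image of the homomorphism `Ȟ²(M; ℤ) → Ȟ²(M; ℝ)` that is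
induced by the inclusion `k ↦ 2πk` of `ℤ` in `ℝ`. -/
def IsIntegralClass (κ : DiffForm.DeRhamH2 n M) : Prop :=
  ∃ (η : DiffForm.closedForms n M 2) (m : Cech.H2 M ℤ),
    DiffForm.deRhamClass η = κ ∧ DeRhamCechRel η (Cech.H2map M twoPiZ m)

end Integral

/-! ### Hermitian connexions and their curvature -/

section Connection

variable (n : ℕ) {M : Type*} [TopologicalSpace M] [ChartedSpace (EuclideanSpace ℝ (Fin n)) M]
  [IsManifold (𝓡 n) ∞ M]
  (L : M → Type*) [∀ x, NormedAddCommGroup (L x)] [∀ x, InnerProductSpace ℂ (L x)]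
  [TopologicalSpace (Bundle.TotalSpace ℂ L)] [FiberBundle ℂ L] [VectorBundle ℂ ℂ L] [VectorBundle ℝ ℂ L]

/-- The hermitian structure on the fibres of `L` is smooth: the inner product of two smooth sections
over an open set is a smooth function. -/
class IsSmoothHermitianBundle : Prop where
  contMDiffOn_inner : ∀ (U : Set M) (s t : (x : M) → L x), IsOpen U →
    ContMDiffOn (𝓡 n) ((𝓡 n).prod 𝓘(ℝ, ℂ)) ∞ (fun x => (⟨x, s x⟩ : Bundle.TotalSpace ℂ L)) U →
    ContMDiffOn (𝓡 n) ((𝓡 n).prod 𝓘(ℝ, ℂ)) ∞ (fun x => (⟨x, t x⟩ : Bundle.TotalSpace ℂ L)) U →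
    ContMDiffOn (𝓡 n) 𝓘(ℝ, ℂ) ∞ (fun x => inner ℂ (s x) (t x)) U

/-- A hermitian connexion on a hermitian line bundle `L` over the real manifold `M`: a smooth
covariant derivative (`∇ σ x v` is `∇_v σ` at `x`) that satisfies the Leibniz rule for
complex-valued functions and is compatible with the hermitian structure. The inner product is
conjugate linear in its first argument. -/
structure HermitianConnection extends CovariantDerivative (𝓡 n) ℂ L where
  smooth : CovariantDerivative.ContMDiffCovariantDerivative toCovariantDerivative ∞
  leibniz_complex : ∀ (f : M → ℂ) (σ : (x : M) → L x) (x : M),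
    MDifferentiableAt (𝓡 n) 𝓘(ℝ, ℂ) f x →
    MDifferentiableAt (𝓡 n) ((𝓡 n).prod 𝓘(ℝ, ℂ)) (fun y => (⟨y, σ y⟩ : Bundle.TotalSpace ℂ L)) x →
    ∀ v : TangentSpace (𝓡 n) x,
      toFun (fun y => f y • σ y) x v = mvfderiv (𝓡 n) f x v • σ x + f x • toFun σ x v
  metric : ∀ (σ τ : (x : M) → L x) (x : M),
    MDifferentiableAt (𝓡 n) ((𝓡 n).prod 𝓘(ℝ, ℂ)) (fun y => (⟨y, σ y⟩ : Bundle.TotalSpace ℂ L)) x →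
    MDifferentiableAt (𝓡 n) ((𝓡 n).prod 𝓘(ℝ, ℂ)) (fun y => (⟨y, τ y⟩ : Bundle.TotalSpace ℂ L)) x →
    ∀ v : TangentSpace (𝓡 n) x,
      mvfderiv (𝓡 n) (fun y => inner ℂ (σ y) (τ y)) x v =
        inner ℂ (toFun σ x v) (τ x) + inner ℂ (σ x) (toFun τ x v)

variable {n L}

/-- The complex `2`-form `Ω` is the curvature of the connexion `∇`:
`Ω(X, Y) s = ∇_X ∇_Y s - ∇_Y ∇_X s - ∇_[X,Y] s` for all smooth vector fields `X`, `Y` and all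
smooth sections `s`. -/
def HermitianConnection.HasCurvature (D : HermitianConnection n L) (Ω : DiffForm n M 2 ℂ) : Prop :=
  ∀ (X Y : (x : M) → TangentSpace (𝓡 n) x) (s : (x : M) → L x),
    ContMDiff (𝓡 n) (𝓡 n).tangent ∞ (fun x => (⟨x, X x⟩ : TangentBundle (𝓡 n) M)) →
    ContMDiff (𝓡 n) (𝓡 n).tangent ∞ (fun x => (⟨x, Y x⟩ : TangentBundle (𝓡 n) M)) →
    ContMDiff (𝓡 n) ((𝓡 n).prod 𝓘(ℝ, ℂ)) ∞ (fun x => (⟨x, s x⟩ : Bundle.TotalSpace ℂ L)) →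
    ∀ x : M, Ω x ![X x, Y x] • s x =
      D.toFun (fun y => D.toFun s y (Y y)) x (X x) - D.toFun (fun y => D.toFun s y (X y)) x (Y x)
        - D.toFun s x (VectorField.mlieBracket (𝓡 n) X Y x)

/-- The complex multiple `z w` of a real form. -/
noncomputable def DiffForm.complexMul {k : ℕ} (z : ℂ) (w : DiffForm n M k ℝ) : DiffForm n M k ℂ :=
  fun x => z • Complex.ofRealCLM.compContinuousAlternatingMap (w x)

end Connection

/-!
Near each point the line bundle `L` has a smooth section `s` of norm one (`exists_isUnitSection`).
The fibres are complex lines and the connection is hermitian, so `∇ s = i A s` for a real `1`-form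
`A`, the connection form (`HermitianConnection.toFun_eq_connForm`). Evaluating the curvature on `s`
gives `dA = ω / e` (`HermitianConnection.extDeriv_inChart_connForm`). Hence `ω / e` is locally
exact, so closed.

Two unit sections `s` and `t` differ by the function `g = ⟨t, s⟩` with values in the unit circle,
and `dg = i (A_s - A_t) g`. If `g = exp (i f)` with `f` smooth and real, then `df = A_s - A_t`
(`HermitianConnection.mvfderiv_argNear_inner`). On triple intersections the functions `g` satisfy
the cocycle relation, so the coboundary of the functions `f` takes values in `2πℤ`; it is the image
of an integer cocycle (`Cech.exists_integer_cocycle`) and represents the class of `ω / e`.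

The functions `f` require a cover on whose double intersections the functions `g` have arguments. No
cover with simply connected intersections is needed: by paracompactness there is a pointed cover
such that each `U x` is assigned one of the unit sections, and on the whole of `U x` the transition
functions to the sections assigned to the sets `U y` that meet `U x` differ by less than `1` from
their values at `x` (`PointedCover.exists_refinement`). Such a function has a smooth argument.
-/

open scoped Topology

/-! ### Refinement of open covers -/

section Covers

/-- Let `V` be an open cover of a paracompact Hausdorff space, and let `N i j x` be a neighbourhood
of each point `x` of `V i ∩ V j`. Then there is a pointed cover `U` finer than `V` such that
`U x ⊆ N i j x` whenever `V i` and `V j` are the members of `V` assigned to `U x` and to some `U y`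
that meets `U x`. This replaces a good cover: functions given on the sets `V i ∩ V j` are controlled
on the whole of `U x`, and nothing has to be known about the topology of the intersections. -/
theorem PointedCover.exists_refinement {M ι : Type*} [TopologicalSpace M] [T2Space M]
    [ParacompactSpace M] (V : ι → Set M) (hV : ∀ i, IsOpen (V i)) (hcov : ⋃ i, V i = Set.univ)
    (N : ι → ι → M → Set M) (hN : ∀ i j, ∀ x ∈ V i ∩ V j, N i j x ∈ 𝓝 x) :
    ∃ (U : PointedCover M) (c : M → ι), (∀ x, U x ⊆ V (c x)) ∧
      ∀ x y, (U x ∩ U y).Nonempty → x ∈ V (c x) ∩ V (c y) ∧ U x ⊆ N (c x) (c y) x := by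
  obtain ⟨v, hvo, hvc, hvf, hvV⟩ := precise_refinement V hV hcov
  obtain ⟨w, hwc, hwo, hwv⟩ := exists_iUnion_eq_closure_subset hvo hvf.point_finite hvc
  have hwf : LocallyFinite fun i => closure (w i) := hvf.subset hwv
  -- `w` is a locally finite cover whose closures shrink `V`; `x` is assigned to some `w i ∋ x`.
  choose c hc using fun x => Set.mem_iUnion.1 (hwc.symm ▸ Set.mem_univ x : x ∈ ⋃ i, w i)
  have hfin : ∀ x, {i | x ∈ closure (w i)}.Finite := fun x => hwf.point_finite x
  have hmem : ∀ x i, x ∈ closure (w i) → x ∈ V (c x) ∩ V i := fun x i hi =>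
    ⟨hvV _ (hwv _ (subset_closure (hc x))), hvV _ (hwv _ hi)⟩
  -- `T x` misses every `w i` whose closure does not contain `x`, which leaves finitely many `i`
  -- for which the neighbourhoods `N (c x) i x` have to be intersected.
  let T : M → Set M := fun x =>
    w (c x) ∩ (⋂ i, ⋂ _ : x ∉ closure (w i), (closure (w i))ᶜ) ∩
      ⋂ i ∈ {i | x ∈ closure (w i)}, N (c x) i x
  have hT : ∀ x, T x ∈ 𝓝 x := fun x => by
    refine Filter.inter_mem (Filter.inter_mem ((hwo _).mem_nhds (hc x)) ?_) ?_
    · exact hwf.iInter_compl_mem_nhds (fun i => isClosed_closure) x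
    · exact (Filter.biInter_mem (hfin x)).2 fun i hi => hN _ _ _ (hmem x i hi)
  refine ⟨⟨fun x => interior (T x), fun x => isOpen_interior, fun x =>
    mem_interior_iff_mem_nhds.2 (hT x)⟩, c, fun x y hy => ?_, fun x y ⟨p, hpx, hpy⟩ => ?_⟩
  · exact hvV _ (hwv _ (subset_closure (interior_subset hy).1.1))
  · have hpx' := interior_subset hpx
    have hpy' := interior_subset hpy
    have hx : x ∈ closure (w (c y)) := by
      by_contra h
      have := Set.mem_iInter₂.1 hpx'.1.2 (c y) h
      exact this (subset_closure hpy'.1.1)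
    exact ⟨hmem x _ hx, fun q hq => Set.mem_iInter₂.1 (interior_subset hq).2 (c y) hx⟩

end Covers

/-! ### Extension of local sections, and vector fields with constant coordinates -/

section Extension

variable {n : ℕ} {M : Type*} [TopologicalSpace M] [T2Space M]
    [ChartedSpace (EuclideanSpace ℝ (Fin n)) M] [IsManifold (𝓡 n) ∞ M]
  {F : Type*} [NormedAddCommGroup F] [NormedSpace ℝ F] {V : M → Type*}
  [TopologicalSpace (Bundle.TotalSpace F V)] [∀ x, AddCommGroup (V x)] [∀ x, Module ℝ (V x)]
  [∀ x : M, TopologicalSpace (V x)] [FiberBundle F V] [VectorBundle ℝ F V]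

/-- A section that is smooth on an open set agrees near each point of that set with a smooth section
over the whole manifold: multiply it by a bump function. -/
theorem exists_contMDiff_section_eventuallyEq {u : Set M} (hu : IsOpen u) {s : (x : M) → V x}
    (hs : ContMDiffOn (𝓡 n) ((𝓡 n).prod 𝓘(ℝ, F)) ∞
      (fun x => (⟨x, s x⟩ : Bundle.TotalSpace F V)) u)
    {x : M} (hx : x ∈ u) :
    ∃ t : (x : M) → V x,
      ContMDiff (𝓡 n) ((𝓡 n).prod 𝓘(ℝ, F)) ∞ (fun x => (⟨x, t x⟩ : Bundle.TotalSpace F V)) ∧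
      ∀ᶠ y in 𝓝 x, t y = s y := by
  obtain ⟨ψ, -, hψ⟩ := (SmoothBumpFunction.nhds_basis_tsupport (I := 𝓡 n) x).mem_iff.1
    (hu.mem_nhds hx)
  refine ⟨(ψ : M → ℝ) • s,
    ContMDiffOn.smul_section_of_tsupport ψ.contMDiff.contMDiffOn hu hψ hs, ?_⟩
  filter_upwards [ψ.eventuallyEq_one] with y hy
  simp [hy]

end Extension

section Coordinates

variable {n : ℕ} {M : Type*} [TopologicalSpace M]
    [ChartedSpace (EuclideanSpace ℝ (Fin n)) M]

theorem mvfderiv_congr_of_eventuallyEq {F : Type*} [NormedAddCommGroup F] [NormedSpace ℝ F]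
    {f g : M → F} {x : M} (h : f =ᶠ[𝓝 x] g) : mvfderiv (𝓡 n) f x = mvfderiv (𝓡 n) g x := by
  ext v
  exact congrArg (fun T : EuclideanSpace ℝ (Fin n) →L[ℝ] F => T v) h.mfderiv_eq

theorem mvfderiv_comp_of_hasFDerivAt {F G : Type*} [NormedAddCommGroup F] [NormedSpace ℝ F]
    [NormedAddCommGroup G] [NormedSpace ℝ G] {φ : F → G} {φ' : F →L[ℝ] G} {f : M → F} {x : M}
    (hφ : HasFDerivAt φ φ' (f x)) (hf : MDifferentiableAt (𝓡 n) 𝓘(ℝ, F) f x)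
    (v : TangentSpace (𝓡 n) x) :
    mvfderiv (𝓡 n) (fun y => φ (f y)) x v = φ' (mvfderiv (𝓡 n) f x v) := by
  have h := hφ.hasMFDerivAt.comp x hf.hasMFDerivAt
  exact congrArg (fun T : EuclideanSpace ℝ (Fin n) →L[ℝ] G => T v) h.mfderiv

variable [IsManifold (𝓡 n) ∞ M]

/-- The constant vector field on `ℝⁿ` with value `u`, typed as a section of the tangent bundle. -/
def constField (u y : EuclideanSpace ℝ (Fin n)) : TangentSpace (𝓡 n) y := u

theorem contMDiffAt_constField (u y : EuclideanSpace ℝ (Fin n)) :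
    ContMDiffAt (𝓡 n) (𝓡 n).tangent ∞ (fun y => (⟨y, constField u y⟩ :
      TangentBundle (𝓡 n) (EuclideanSpace ℝ (Fin n)))) y :=
  contMDiffAt_vectorSpace_iff_contDiffAt.2 contDiffAt_const

/-- The vector field on the source of the chart at `c` that has constant coordinates `u` there: the
pullback of a constant vector field by the chart. Its values outside the source are irrelevant. -/
noncomputable def coordField (c : M) (u : EuclideanSpace ℝ (Fin n)) :
    (x : M) → TangentSpace (𝓡 n) x :=
  VectorField.mpullback (𝓡 n) (𝓡 n) (extChartAt (𝓡 n) c) (constField u)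

theorem coordField_eq (c : M) (u : EuclideanSpace ℝ (Fin n)) {y : EuclideanSpace ℝ (Fin n)}
    (hy : y ∈ (extChartAt (𝓡 n) c).target) :
    coordField c u ((extChartAt (𝓡 n) c).symm y) =
      mfderiv (𝓡 n) (𝓡 n) (extChartAt (𝓡 n) c).symm y (constField u y) := by
  have h1 := mfderiv_extChartAt_comp_mfderivWithin_extChartAt_symm (I := 𝓡 n) hy
  have h2 := isInvertible_mfderiv_extChartAt (I := 𝓡 n) ((extChartAt (𝓡 n) c).map_target hy)
  rw [ModelWithCorners.range_eq_univ, mfderivWithin_univ] at h1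
  have h3 : mfderiv (𝓡 n) (𝓡 n) (extChartAt (𝓡 n) c) ((extChartAt (𝓡 n) c).symm y)
      (mfderiv (𝓡 n) (𝓡 n) (extChartAt (𝓡 n) c).symm y (constField u y)) =
        constField u (extChartAt (𝓡 n) c ((extChartAt (𝓡 n) c).symm y)) :=
    congrArg (fun L => L u) h1
  rw [coordField, VectorField.mpullback_apply]
  obtain ⟨e, he⟩ := h2
  rw [← he] at h3 ⊢
  rw [ContinuousLinearMap.inverse_equiv]
  exact (e.symm_apply_eq).2 h3.symm

/-- The chart expression of a form is the form evaluated on fields with constant coordinates. -/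
theorem DiffForm.inChart_apply_coordField {k : ℕ} (w : DiffForm n M k ℝ) (c : M)
    {y : EuclideanSpace ℝ (Fin n)} (hy : y ∈ (extChartAt (𝓡 n) c).target)
    (u : Fin k → EuclideanSpace ℝ (Fin n)) :
    w.inChart c y u = w ((extChartAt (𝓡 n) c).symm y)
      (fun i => coordField c (u i) ((extChartAt (𝓡 n) c).symm y)) := by
  simp only [coordField_eq c _ hy]
  rfl

theorem contMDiffOn_coordField (c : M) (u : EuclideanSpace ℝ (Fin n)) :
    ContMDiffOn (𝓡 n) (𝓡 n).tangent ∞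
      (fun x => (⟨x, coordField c u x⟩ : TangentBundle (𝓡 n) M)) (extChartAt (𝓡 n) c).source := by
  intro x hx
  exact (ContMDiffAt.mpullback_vectorField_preimage (n := ∞) (contMDiffAt_constField u _)
    (contMDiffAt_extChartAt' (by simpa using hx)) (isInvertible_mfderiv_extChartAt hx)
    (by simp)).contMDiffWithinAt

theorem mlieBracket_coordField (c : M) (u v : EuclideanSpace ℝ (Fin n)) {x : M}
    (hx : x ∈ (extChartAt (𝓡 n) c).source) :
    VectorField.mlieBracket (𝓡 n) (coordField c u) (coordField c v) x = 0 := by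
  have h2 : minSmoothness ℝ 2 ≤ (∞ : WithTop ℕ∞) := by
    rw [minSmoothness_of_isRCLikeNormedField]; exact WithTop.coe_le_coe.2 le_top
  have : IsManifold (𝓡 n) (minSmoothness ℝ 2) M := .of_le h2
  have hb : VectorField.mlieBracket (𝓡 n) (constField u) (constField v) = 0 := by
    rw [← VectorField.mlieBracketWithin_univ, VectorField.mlieBracketWithin_eq_lieBracketWithin]
    funext y
    change VectorField.lieBracketWithin ℝ (fun _ => u) (fun _ => v) Set.univ y = 0
    simp [VectorField.lieBracket_eq]
  have := VectorField.mpullback_mlieBracket (I := 𝓡 n) (I' := 𝓡 n)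
    (f := extChartAt (𝓡 n) c) (V := constField u) (W := constField v) (x₀ := x) (n := ∞)
    ((contMDiffAt_constField u _).mdifferentiableAt (by simp))
    ((contMDiffAt_constField v _).mdifferentiableAt (by simp))
    (contMDiffAt_extChartAt' (by simpa using hx)) h2
  refine this.symm.trans ?_
  rw [hb]
  simp [VectorField.mpullback_apply]

end Coordinates

/-! ### Unit sections and connection forms -/

section LineBundle

variable {n : ℕ} {M : Type*} [TopologicalSpace M]
    [ChartedSpace (EuclideanSpace ℝ (Fin n)) M] [IsManifold (𝓡 n) ∞ M]
    {L : M → Type*} [∀ x, NormedAddCommGroup (L x)] [∀ x, InnerProductSpace ℂ (L x)]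
    [TopologicalSpace (Bundle.TotalSpace ℂ L)] [FiberBundle ℂ L]

/-- The fibres are complex lines, so a unit vector is an orthonormal basis. -/
theorem inner_smul_self_of_norm_eq_one [VectorBundle ℂ ℂ L] {x : M} {s : L x} (hs : ‖s‖ = 1)
    (t : L x) : inner ℂ s t • s = t := by
  have e : L x ≃L[ℂ] ℂ := (trivializationAt ℂ L x).continuousLinearEquivAt ℂ x
    (FiberBundle.mem_baseSet_trivializationAt' x)
  have h1 : Module.finrank ℂ (L x) = 1 := by rw [e.toLinearEquiv.finrank_eq, Module.finrank_self]
  obtain ⟨c, rfl⟩ := exists_smul_eq_of_finrank_eq_one h1 (x := s) (by rintro rfl; simp at hs) t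
  rw [inner_smul_right, inner_self_eq_norm_sq_to_K, hs]
  simp

variable (n) in
/-- A smooth section of `L` over all of `M` that has norm one on the open set `V`. It is
global because the connection and its curvature are defined on global sections. -/
structure IsUnitSection (s : (x : M) → L x) (V : Set M) : Prop where
  isOpen : IsOpen V
  contMDiff : ContMDiff (𝓡 n) ((𝓡 n).prod 𝓘(ℝ, ℂ)) ∞
    (fun x => (⟨x, s x⟩ : Bundle.TotalSpace ℂ L))
  norm_eq_one : ∀ x ∈ V, ‖s x‖ = 1

variable [VectorBundle ℝ ℂ L]

/-- Normalise a local frame and extend it. -/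
theorem exists_isUnitSection [T2Space M] [ContMDiffVectorBundle ∞ ℂ L (𝓡 n)]
    [IsSmoothHermitianBundle n L] (x : M) :
    ∃ (s : (x : M) → L x) (V : Set M), x ∈ V ∧ IsUnitSection n s V := by
  let e := trivializationAt ℂ L x
  let t : (y : M) → L y := fun y => e.symm y 1
  have ht : ContMDiffOn (𝓡 n) ((𝓡 n).prod 𝓘(ℝ, ℂ)) ∞
      (fun x => (⟨x, t x⟩ : Bundle.TotalSpace ℂ L)) e.baseSet := by
    rw [e.contMDiffOn_section_baseSet_iff]
    exact (contMDiffOn_const (c := (1 : ℂ))).congr fun y hy => by simp [t, e.apply_mk_symm hy]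
  have ht0 : ∀ y ∈ e.baseSet, t y ≠ 0 := fun y hy h => by
    have h1 : (e ⟨y, t y⟩).2 = 1 := by simp [t, e.apply_mk_symm hy]
    rw [h, (e.linear ℝ hy).map_zero] at h1
    exact zero_ne_one h1
  have hn : ContMDiffOn (𝓡 n) 𝓘(ℝ, ℝ) ∞ (fun y => ‖t y‖⁻¹) e.baseSet := by
    have h1 := (Complex.reCLM.contDiff.contMDiff (n := ∞)).comp_contMDiffOn
      (IsSmoothHermitianBundle.contMDiffOn_inner (n := n) e.baseSet t t e.open_baseSet ht ht)
    intro y hy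
    have h2 : (0 : ℝ) < ‖t y‖ ^ 2 := by have := ht0 y hy; positivity
    have h3 : ∀ y, Complex.re (inner ℂ (t y) (t y)) = ‖t y‖ ^ 2 := fun y => by
      rw [inner_self_eq_norm_sq_to_K]; norm_cast
    have h4 : ContDiffAt ℝ ∞ (fun r : ℝ => (√r)⁻¹) (‖t y‖ ^ 2) :=
      (contDiffAt_id.sqrt h2.ne').inv (Real.sqrt_ne_zero'.2 h2)
    have h5 := (h3 y ▸ h4.contMDiffAt : ContMDiffAt 𝓘(ℝ, ℝ) 𝓘(ℝ, ℝ) ∞ (fun r : ℝ => (√r)⁻¹)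
      (Complex.re (inner ℂ (t y) (t y)))).comp_contMDiffWithinAt y (h1 y hy)
    refine h5.congr_of_eventuallyEq (Filter.Eventually.of_forall fun z => ?_) ?_ <;>
    · simp only [Function.comp_def, Complex.reCLM_apply, h3]
      rw [Real.sqrt_sq (norm_nonneg _)]
  obtain ⟨s, hs, hst⟩ := exists_contMDiff_section_eventuallyEq e.open_baseSet
    (hn.smul_section ht) (FiberBundle.mem_baseSet_trivializationAt' x)
  have hev : ∀ᶠ y in 𝓝 x, ‖s y‖ = 1 := by
    filter_upwards [hst, e.open_baseSet.mem_nhds (FiberBundle.mem_baseSet_trivializationAt' x)]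
      with y hy hye
    rw [hy]
    simp [norm_smul, ht0 y hye]
  obtain ⟨V, hV, hVo, hx⟩ := eventually_nhds_iff.1 hev
  exact ⟨s, V, hx, hVo, hs, hV⟩

namespace HermitianConnection

/-- The connection form of a section `s`: the real `1`-form `v ↦ Im ⟨s, ∇_v s⟩`. Where `s` has norm
one it satisfies `∇ s = i A s`, see `toFun_eq_connForm`. -/
noncomputable def connForm (D : HermitianConnection n L) (s : (x : M) → L x) : DiffForm n M 1 ℝ :=
  fun x => ContinuousAlternatingMap.ofSubsingleton ℝ (TangentSpace (𝓡 n) x) ℝ 0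
    ((Complex.imCLM ∘L (innerSL ℂ (s x)).restrictScalars ℝ) ∘L D.toFun s x)

theorem connForm_apply (D : HermitianConnection n L) (s : (x : M) → L x) (x : M)
    (v : Fin 1 → TangentSpace (𝓡 n) x) :
    D.connForm s x v = (inner ℂ (s x) (D.toFun s x (v 0))).im := rfl

variable {D : HermitianConnection n L} {s : (x : M) → L x} {V : Set M}

theorem toFun_eq_connForm [VectorBundle ℂ ℂ L] (hs : IsUnitSection n s V) {x : M} (hx : x ∈ V)
    (v : TangentSpace (𝓡 n) x) :
    D.toFun s x v = (Complex.I * (D.connForm s x ![v] : ℝ)) • s x := by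
  have hd := (hs.contMDiff x).mdifferentiableAt (by simp)
  have h1 := D.metric s s x hd hd v
  have h2 : mvfderiv (𝓡 n) (fun y => inner ℂ (s y) (s y)) x = 0 := by
    have h3 : (fun y => inner ℂ (s y) (s y)) =ᶠ[𝓝 x] fun _ => (1 : ℂ) := by
      filter_upwards [hs.isOpen.mem_nhds hx] with y hy
      rw [inner_self_eq_norm_sq_to_K, hs.norm_eq_one y hy]
      simp
    rw [mvfderiv_congr_of_eventuallyEq h3, mvfderiv_const]
  -- `⟨s, s⟩ = 1` is constant, so metric compatibility makes `⟨s, ∇_v s⟩` imaginary.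
  have h3 : (inner ℂ (s x) (D.toFun s x v)).re = 0 := by
    rw [h2, ← inner_conj_symm] at h1
    have := congrArg Complex.re h1
    rw [Complex.add_re, Complex.conj_re, zero_apply, Complex.zero_re] at this
    linarith
  rw [connForm_apply]
  conv_lhs => rw [← inner_smul_self_of_norm_eq_one (hs.norm_eq_one x hx) (D.toFun s x v)]
  congr 1
  apply Complex.ext <;> simp [h3]

theorem contMDiffOn_connForm_apply [IsSmoothHermitianBundle n L]
    (hs : ContMDiff (𝓡 n) ((𝓡 n).prod 𝓘(ℝ, ℂ)) ∞
      (fun x => (⟨x, s x⟩ : Bundle.TotalSpace ℂ L)))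
    {X : (x : M) → TangentSpace (𝓡 n) x} {W : Set M} (hW : IsOpen W)
    (hX : ContMDiffOn (𝓡 n) (𝓡 n).tangent ∞ (fun x => (⟨x, X x⟩ : TangentBundle (𝓡 n) M)) W) :
    ContMDiffOn (𝓡 n) 𝓘(ℝ, ℝ) ∞ (fun x => D.connForm s x ![X x]) W := by
  have h1 := (D.smooth.contMDiff.contMDiff (σ := s) hs.contMDiffOn).mono (Set.subset_univ W)
  have h2 := ContMDiffOn.clm_bundle_apply h1 hX
  have h3 := IsSmoothHermitianBundle.contMDiffOn_inner (L := L) (n := n) W _ _ hW hs.contMDiffOn h2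
  exact (Complex.imCLM.contDiff.contMDiff (n := ∞)).comp_contMDiffOn h3

end HermitianConnection
end LineBundle

/-! ### The curvature is the exterior derivative of the connection form -/

section Curvature

variable {n : ℕ} {M : Type*} [TopologicalSpace M]
    [ChartedSpace (EuclideanSpace ℝ (Fin n)) M] [IsManifold (𝓡 n) ∞ M]
    {L : M → Type*} [∀ x, NormedAddCommGroup (L x)] [∀ x, InnerProductSpace ℂ (L x)]
    [TopologicalSpace (Bundle.TotalSpace ℂ L)] [FiberBundle ℂ L] [VectorBundle ℝ ℂ L]

namespace HermitianConnection

variable {D : HermitianConnection n L} {s : (x : M) → L x} {V : Set M}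

/-- The structure equation: on a unit section with `∇ s = i A s` the curvature is `i dA`, where `dA`
is written out on vector fields as `X (A Y) - Y (A X) - A [X, Y]`. -/
theorem curvature_eq [VectorBundle ℂ ℂ L] [IsSmoothHermitianBundle n L] {e : ℝ}
    {w : DiffForm n M 2 ℝ} (hcurv : D.HasCurvature (DiffForm.complexMul (Complex.I / e) w))
    (hs : IsUnitSection n s V) {x : M} (hx : x ∈ V) {X Y : (x : M) → TangentSpace (𝓡 n) x}
    (hX : ContMDiff (𝓡 n) (𝓡 n).tangent ∞ (fun x => (⟨x, X x⟩ : TangentBundle (𝓡 n) M)))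
    (hY : ContMDiff (𝓡 n) (𝓡 n).tangent ∞ (fun x => (⟨x, Y x⟩ : TangentBundle (𝓡 n) M))) :
    e⁻¹ * w x ![X x, Y x] = mvfderiv (𝓡 n) (fun y => D.connForm s y ![Y y]) x (X x)
      - mvfderiv (𝓡 n) (fun y => D.connForm s y ![X y]) x (Y x)
      - D.connForm s x ![VectorField.mlieBracket (𝓡 n) X Y x] := by
  -- `∇_X (i A(Y) s) = (i X(A(Y)) - A(X) A(Y)) s`; the second term is symmetric in `X` and `Y`.
  have key : ∀ X Y : (x : M) → TangentSpace (𝓡 n) x,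
      ContMDiff (𝓡 n) (𝓡 n).tangent ∞ (fun x => (⟨x, Y x⟩ : TangentBundle (𝓡 n) M)) →
      D.toFun (fun y => D.toFun s y (Y y)) x (X x) =
        (Complex.I * (mvfderiv (𝓡 n) (fun y => D.connForm s y ![Y y]) x (X x) : ℝ) -
          D.connForm s x ![X x] * D.connForm s x ![Y x]) • s x := by
    intro X Y hY
    let f : M → ℂ := fun y => (Complex.I • Complex.ofRealCLM) (D.connForm s y ![Y y])
    have hev : ∀ᶠ y in 𝓝 x, D.toFun s y (Y y) = f y • s y := by
      filter_upwards [hs.isOpen.mem_nhds hx] with y hy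
      exact toFun_eq_connForm hs hy (Y y)
    have ha := ((contMDiffOn_connForm_apply (D := D) hs.contMDiff isOpen_univ
      hY.contMDiffOn).contMDiffAt (x := x) Filter.univ_mem).mdifferentiableAt (by simp)
    have h1 : MDifferentiableAt (𝓡 n) ((𝓡 n).prod 𝓘(ℝ, ℂ))
        (fun y => (⟨y, D.toFun s y (Y y)⟩ : Bundle.TotalSpace ℂ L)) x :=
      ((ContMDiffOn.clm_bundle_apply
        (D.smooth.contMDiff.contMDiff (σ := s) hs.contMDiff.contMDiffOn) hY.contMDiffOn).contMDiffAt
          (x := x) Filter.univ_mem).mdifferentiableAt (by simp)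
    have h2 : MDifferentiableAt (𝓡 n) ((𝓡 n).prod 𝓘(ℝ, ℂ))
        (fun y => (⟨y, f y • s y⟩ : Bundle.TotalSpace ℂ L)) x := by
      refine h1.congr_of_eventuallyEq ?_
      filter_upwards [hev] with y hy
      rw [hy]
    have hf : MDifferentiableAt (𝓡 n) 𝓘(ℝ, ℂ) f x :=
      ((Complex.I • Complex.ofRealCLM).contDiff.contMDiff (n := ∞)).mdifferentiableAt
        (by simp) |>.comp x ha
    rw [D.isCovariantDerivativeOn.congr_of_eventuallyEq h1 h2 Filter.univ_mem hev,
      D.leibniz_complex f s x hf ((hs.contMDiff x).mdifferentiableAt (by simp)),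
      mvfderiv_comp_of_hasFDerivAt (Complex.I • Complex.ofRealCLM).hasFDerivAt ha,
      toFun_eq_connForm hs hx, smul_smul, ← add_smul]
    congr 1
    simp only [f, smul_apply, Complex.ofRealCLM_apply, smul_eq_mul]
    linear_combination (D.connForm s x ![Y x] * D.connForm s x ![X x] : ℂ) * Complex.I_mul_I
  have h := hcurv X Y s hX hY hs.contMDiff x
  rw [key X Y hY, key Y X hX, toFun_eq_connForm hs hx, ← sub_smul, ← sub_smul] at h
  have h0 : s x ≠ 0 := fun h0 => by simpa [h0] using hs.norm_eq_one x hx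
  have h1 := smul_left_injective ℂ h0 h
  have h2 : (DiffForm.complexMul (Complex.I / e) w) x ![X x, Y x] =
    Complex.I / e * (w x ![X x, Y x] : ℝ) := rfl
  rw [h2] at h1
  have h3 := congrArg Complex.im h1
  have h4 : (Complex.I / e * (w x ![X x, Y x] : ℝ)) = Complex.I * (e⁻¹ * w x ![X x, Y x] : ℝ) := by
    push_cast; ring
  rw [h4] at h3
  simpa using h3

theorem smoothOn_connForm [IsSmoothHermitianBundle n L]
    (hs : ContMDiff (𝓡 n) ((𝓡 n).prod 𝓘(ℝ, ℂ)) ∞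
      (fun x => (⟨x, s x⟩ : Bundle.TotalSpace ℂ L))) :
    (D.connForm s).SmoothOn Set.univ := by
  intro c
  rw [Set.preimage_univ, Set.inter_univ]
  let T := ContinuousAlternatingMap.ofSubsingletonLIE (𝕜 := ℝ) (E := EuclideanSpace ℝ (Fin n))
    (F := ℝ) (0 : Fin 1)
  have h : ContDiffOn ℝ ∞ (fun y => T.symm ((D.connForm s).inChart c y))
      (extChartAt (𝓡 n) c).target := by
    rw [contDiffOn_clm_apply]
    intro u
    have h1 := (contMDiffOn_connForm_apply (D := D) hs (isOpen_extChartAt_source c)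
      (contMDiffOn_coordField c u)).comp (contMDiffOn_extChartAt_symm (n := ∞) c)
      (fun y hy => (extChartAt (𝓡 n) c).map_target hy)
    refine h1.contDiffOn.congr fun y hy => ?_
    refine ((D.connForm s).inChart_apply_coordField c hy (fun _ => u)).trans ?_
    simp only [Function.comp_def]
    congr 1
    ext i
    rw [Subsingleton.elim i 0]
    rfl
  exact (T.contDiff.comp_contDiffOn h).congr fun y _ => (T.apply_symm_apply _).symm

/-- The equation `dA = ω / e`, read at any point of any chart. The exterior derivative of a form on
`M` at a point uses the chart at that point only; knowing the equation in that chart on a whole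
neighbourhood also gives `d (ω / e) = 0`, without the chart independence of `d`. -/
theorem extDeriv_inChart_connForm [T2Space M] [VectorBundle ℂ ℂ L] [IsSmoothHermitianBundle n L]
    {e : ℝ} {w : DiffForm n M 2 ℝ}
    (hcurv : D.HasCurvature (DiffForm.complexMul (Complex.I / e) w))
    (hs : IsUnitSection n s V) {c : M} {y : EuclideanSpace ℝ (Fin n)}
    (hy : y ∈ (extChartAt (𝓡 n) c).target) (hyV : (extChartAt (𝓡 n) c).symm y ∈ V) :
    extDeriv ((D.connForm s).inChart c) y = (e⁻¹ • w : DiffForm n M 2 ℝ).inChart c y := by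
  have hd : DifferentiableAt ℝ ((D.connForm s).inChart c) y := by
    have := smoothOn_connForm (D := D) hs.contMDiff c
    rw [Set.preimage_univ, Set.inter_univ] at this
    exact ((this y hy).contDiffAt ((isOpen_extChartAt_target c).mem_nhds hy)).differentiableAt
      (by simp)
  set x := (extChartAt (𝓡 n) c).symm y with hxy
  have hx : x ∈ (extChartAt (𝓡 n) c).source := (extChartAt (𝓡 n) c).map_target hy
  have hder : ∀ u v : EuclideanSpace ℝ (Fin n),
      fderiv ℝ (fun z => (D.connForm s).inChart c z ![v]) y u =
        mvfderiv (𝓡 n) (fun p => D.connForm s p ![coordField c v p]) x (coordField c u x) := by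
    intro u v
    have ha := (contMDiffOn_connForm_apply (D := D) hs.contMDiff (isOpen_extChartAt_source c)
      (contMDiffOn_coordField c v)).contMDiffAt ((isOpen_extChartAt_source c).mem_nhds hx)
    have hsymm := (contMDiffOn_extChartAt_symm (I := 𝓡 n) (n := ∞) c).contMDiffAt
      ((isOpen_extChartAt_target c).mem_nhds hy)
    have hev : (fun z => (D.connForm s).inChart c z ![v]) =ᶠ[𝓝 y]
        (fun p => D.connForm s p ![coordField c v p]) ∘ (extChartAt (𝓡 n) c).symm := by
      filter_upwards [(isOpen_extChartAt_target c).mem_nhds hy] with z hz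
      refine ((D.connForm s).inChart_apply_coordField c hz ![v]).trans ?_
      simp only [Function.comp_def]
      congr 1
      ext i
      rw [Subsingleton.elim i 0]
      rfl
    rw [hev.fderiv_eq, ← mfderiv_eq_fderiv]
    refine (mfderiv_comp_apply (f := (extChartAt (𝓡 n) c).symm) y (ha.mdifferentiableAt (by simp))
      (hsymm.mdifferentiableAt (by simp)) (constField u y)).trans ?_
    rw [hxy, coordField_eq c u hy]
    rfl
  ext u
  rw [extDeriv_apply hd, (e⁻¹ • w : DiffForm n M 2 ℝ).inChart_apply_coordField c hy]
  -- The curvature hypothesis needs global vector fields: extend the coordinate fields.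
  obtain ⟨X, hX, hXe⟩ := exists_contMDiff_section_eventuallyEq (isOpen_extChartAt_source c)
    (contMDiffOn_coordField c (u 0)) hx
  obtain ⟨Y, hY, hYe⟩ := exists_contMDiff_section_eventuallyEq (isOpen_extChartAt_source c)
    (contMDiffOn_coordField c (u 1)) hx
  have h := curvature_eq hcurv hs hyV hX hY
  have hb : VectorField.mlieBracket (𝓡 n) X Y x = 0 := by
    rw [Filter.EventuallyEq.mlieBracket_vectorField_eq hXe hYe, mlieBracket_coordField c _ _ hx]
  have hz : D.connForm s x ![0] = 0 := (D.connForm s x).map_coord_zero 0 rfl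
  rw [hb, hz, sub_zero, hXe.self_of_nhds, hYe.self_of_nhds] at h
  rw [mvfderiv_congr_of_eventuallyEq (g := fun p => D.connForm s p ![coordField c (u 1) p])
    (by filter_upwards [hYe] with p hp; rw [hp]), mvfderiv_congr_of_eventuallyEq
    (f := fun p => D.connForm s p ![X p]) (g := fun p => D.connForm s p ![coordField c (u 0) p])
    (by filter_upwards [hXe] with p hp; rw [hp])] at h
  have h0 : Fin.removeNth 0 u = ![u 1] := by ext i; rw [Subsingleton.elim i 0]; rfl
  have h1 : Fin.removeNth 1 u = ![u 0] := by ext i; rw [Subsingleton.elim i 0]; rfl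
  rw [Fin.sum_univ_two, h0, h1, hder, hder]
  have hu : (fun i => coordField c (u i) x) = ![coordField c (u 0) x, coordField c (u 1) x] := by
    ext i; fin_cases i <;> rfl
  rw [← hxy, hu]
  refine Eq.trans ?_ h.symm
  simp [sub_eq_add_neg]

theorem d_connForm [T2Space M] [VectorBundle ℂ ℂ L] [IsSmoothHermitianBundle n L] {e : ℝ}
    {w : DiffForm n M 2 ℝ} (hcurv : D.HasCurvature (DiffForm.complexMul (Complex.I / e) w))
    (hs : IsUnitSection n s V) {x : M} (hx : x ∈ V) :
    (D.connForm s).d x = (e⁻¹ • w : DiffForm n M 2 ℝ) x := by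
  have hV : (extChartAt (𝓡 n) x).symm (extChartAt (𝓡 n) x x) ∈ V := by simpa using hx
  ext u
  rw [DiffForm.d, extDeriv_inChart_connForm hcurv hs (mem_extChartAt_target x) hV]
  have h1 := mfderivWithin_extChartAt_symm_comp_mfderiv_extChartAt' (I := 𝓡 n)
    (mem_extChartAt_source (I := 𝓡 n) x)
  rw [ModelWithCorners.range_eq_univ, mfderivWithin_univ] at h1
  -- The forms at `x` and at the image of `x` under the chart and back have different types.
  have key : ∀ (p : M) (a : Fin 2 → EuclideanSpace ℝ (Fin n)), p = x →
      (e⁻¹ • w : DiffForm n M 2 ℝ) p a = (e⁻¹ • w : DiffForm n M 2 ℝ) x a := by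
    rintro p a rfl
    rfl
  refine (key _ _ (extChartAt_to_inv (I := 𝓡 n) x)).trans ?_
  congr 1
  funext i
  exact congrArg (fun T : EuclideanSpace ℝ (Fin n) →L[ℝ] EuclideanSpace ℝ (Fin n) => T (u i)) h1

theorem d_smul_of_hasCurvature [T2Space M] [VectorBundle ℂ ℂ L] [IsSmoothHermitianBundle n L]
    {e : ℝ} {w : DiffForm n M 2 ℝ}
    (hcurv : D.HasCurvature (DiffForm.complexMul (Complex.I / e) w))
    (hs : IsUnitSection n s V) {x : M} (hx : x ∈ V) :
    (e⁻¹ • w : DiffForm n M 2 ℝ).d x = 0 := by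
  have hcont := continuousAt_extChartAt_symm (I := 𝓡 n) x
  have hev : (e⁻¹ • w : DiffForm n M 2 ℝ).inChart x =ᶠ[𝓝 (extChartAt (𝓡 n) x x)]
      extDeriv ((D.connForm s).inChart x) := by
    filter_upwards [extChartAt_target_mem_nhds (I := 𝓡 n) x,
      hcont.preimage_mem_nhds (hs.isOpen.mem_nhds (by simpa using hx))] with y hy hyV
    exact (extDeriv_inChart_connForm hcurv hs hy hyV).symm
  have hsm := smoothOn_connForm (D := D) hs.contMDiff x
  rw [Set.preimage_univ, Set.inter_univ] at hsm
  rw [DiffForm.d, hev.extDeriv_eq, extDeriv_extDeriv_apply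
    (hsm.contDiffAt (extChartAt_target_mem_nhds x))
    (by rw [minSmoothness_of_isRCLikeNormedField]; exact WithTop.coe_le_coe.2 le_top)]
  rfl

end HermitianConnection

end Curvature

/-! ### A local branch of the argument -/

section Angle

/-- The branch `z ↦ arg z₀ + arg (z / z₀)` of the argument. It is smooth where `z / z₀` avoids the
closed negative half-line, in particular near `z₀`. -/
noncomputable def Complex.argNear (z₀ z : ℂ) : ℝ := z₀.arg + (Complex.log (z / z₀)).im

variable {z₀ z : ℂ}

theorem Complex.div_mem_slitPlane_of_norm_sub_lt (h₀ : ‖z₀‖ = 1) (h : ‖z - z₀‖ < 1) :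
    z / z₀ ∈ Complex.slitPlane := by
  have h1 : z₀ ≠ 0 := by rintro rfl; simp at h₀
  have h2 : z / z₀ = 1 + (z - z₀) / z₀ := by field_simp; ring
  rw [h2]
  exact Complex.mem_slitPlane_of_norm_lt_one (by rwa [norm_div, h₀, div_one])

theorem Complex.exp_argNear_mul_I (h₀ : ‖z₀‖ = 1) (hz : ‖z‖ = 1) :
    Complex.exp (Complex.argNear z₀ z * Complex.I) = z := by
  have h1 : z₀ ≠ 0 := by rintro rfl; simp at h₀
  have h2 := Complex.norm_mul_exp_arg_mul_I z₀
  have h3 := Complex.norm_mul_exp_arg_mul_I (z / z₀)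
  rw [norm_div, h₀, hz] at h3
  rw [h₀] at h2
  simp only [Complex.ofReal_one, one_mul, div_one] at h2 h3
  rw [Complex.argNear, Complex.log_im, Complex.ofReal_add, add_mul, Complex.exp_add, h2, h3]
  field_simp

theorem Complex.hasFDerivAt_argNear (h : z / z₀ ∈ Complex.slitPlane) :
    HasFDerivAt (Complex.argNear z₀)
      (Complex.imCLM ∘L (ContinuousLinearMap.toSpanSingleton ℂ (z⁻¹ : ℂ)).restrictScalars ℝ) z := by
  have h0 : z₀ ≠ 0 := by rintro rfl; simp at h
  have h1 := ((hasDerivAt_id z).div_const z₀).clog h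
  have h2 : 1 / z₀ / (id z / z₀) = z⁻¹ := by simp only [id]; field_simp
  rw [h2] at h1
  exact (Complex.imCLM.hasFDerivAt.comp z (h1.hasFDerivAt.restrictScalars ℝ)).const_add z₀.arg

theorem Complex.contDiffAt_argNear (h : z / z₀ ∈ Complex.slitPlane) :
    ContDiffAt ℝ ∞ (Complex.argNear z₀) z := by
  have h1 : ContDiffAt ℂ ∞ (fun z => Complex.log (z / z₀)) z :=
    (Complex.contDiffAt_log h).comp z (contDiffAt_id.div_const z₀)
  exact contDiffAt_const.add (Complex.imCLM.contDiff.contDiffAt.comp z (h1.restrict_scalars ℝ))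

end Angle

/-! ### Transition functions between unit sections -/

section Transition

variable {n : ℕ} {M : Type*} [TopologicalSpace M]
    [ChartedSpace (EuclideanSpace ℝ (Fin n)) M]
    {L : M → Type*} [∀ x, NormedAddCommGroup (L x)] [∀ x, InnerProductSpace ℂ (L x)]
    [TopologicalSpace (Bundle.TotalSpace ℂ L)] [FiberBundle ℂ L] {s t : (x : M) → L x} {V W : Set M}

theorem IsUnitSection.norm_inner [VectorBundle ℂ ℂ L] (hs : IsUnitSection n s V)
    (ht : IsUnitSection n t W) {x : M} (hx : x ∈ V ∩ W) : ‖inner ℂ (t x) (s x)‖ = 1 := by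
  have h := congrArg norm (inner_smul_self_of_norm_eq_one (ht.norm_eq_one x hx.2) (s x))
  rwa [norm_smul, ht.norm_eq_one x hx.2, hs.norm_eq_one x hx.1, mul_one] at h

theorem IsUnitSection.contMDiff_inner [IsSmoothHermitianBundle n L] (hs : IsUnitSection n s V)
    (ht : IsUnitSection n t W) : ContMDiff (𝓡 n) 𝓘(ℝ, ℂ) ∞ (fun x => inner ℂ (t x) (s x)) :=
  contMDiffOn_univ.1 (IsSmoothHermitianBundle.contMDiffOn_inner _ t s isOpen_univ
    ht.contMDiff.contMDiffOn hs.contMDiff.contMDiffOn)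

variable [IsManifold (𝓡 n) ∞ M] [VectorBundle ℝ ℂ L] [VectorBundle ℂ ℂ L]
  {D : HermitianConnection n L}

namespace HermitianConnection

/-- For unit sections `s = g t` with connection forms `A_s` and `A_t`, the transition function
`g = ⟨t, s⟩` satisfies `dg = i (A_s - A_t) g`. -/
theorem mvfderiv_inner_of_isUnitSection (hs : IsUnitSection n s V)
    (ht : IsUnitSection n t W) {x : M} (hx : x ∈ V ∩ W) (v : TangentSpace (𝓡 n) x) :
    mvfderiv (𝓡 n) (fun y => inner ℂ (t y) (s y)) x v =
      Complex.I * (D.connForm s x ![v] - D.connForm t x ![v] : ℝ) * inner ℂ (t x) (s x) := by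
  rw [D.metric t s x ((ht.contMDiff x).mdifferentiableAt (by simp))
    ((hs.contMDiff x).mdifferentiableAt (by simp)) v,
    toFun_eq_connForm hs hx.1, toFun_eq_connForm ht hx.2, inner_smul_left, inner_smul_right]
  simp only [map_mul, Complex.conj_I, Complex.conj_ofReal]
  push_cast
  ring

/-- The logarithmic derivative of the transition function: its argument is a potential of the
difference of the connection forms. -/
theorem mvfderiv_argNear_inner [IsSmoothHermitianBundle n L] (hs : IsUnitSection n s V)
    (ht : IsUnitSection n t W) {x : M} (hx : x ∈ V ∩ W) {z₀ : ℂ}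
    (hz : inner ℂ (t x) (s x) / z₀ ∈ Complex.slitPlane) (v : TangentSpace (𝓡 n) x) :
    mvfderiv (𝓡 n) (fun y => Complex.argNear z₀ (inner ℂ (t y) (s y))) x v =
      D.connForm s x ![v] - D.connForm t x ![v] := by
  have h0 : inner ℂ (t x) (s x) ≠ 0 := fun h => by
    have := hs.norm_inner ht hx; rw [h] at this; simp at this
  rw [mvfderiv_comp_of_hasFDerivAt (f := fun y => inner ℂ (t y) (s y))
    (Complex.hasFDerivAt_argNear hz) ((hs.contMDiff_inner ht x).mdifferentiableAt (by simp)),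
    mvfderiv_inner_of_isUnitSection (D := D) hs ht hx]
  simp only [ContinuousLinearMap.comp_apply, ContinuousLinearMap.coe_restrictScalars',
    ContinuousLinearMap.toSpanSingleton_apply, smul_eq_mul, mul_assoc, mul_inv_cancel₀ h0]
  simp

end HermitianConnection

end Transition

/-! ### The integer cocycle -/

section IntegerCocycle

variable {M : Type*} [TopologicalSpace M]

/-- If continuous functions `f x y` on `U x ∩ U y` have a coboundary `f x y + f y z - f x z` with
values in `2πℤ`, then this coboundary is `2π` times an integer cocycle. -/
theorem Cech.exists_integer_cocycle {U : PointedCover M} {f : M → M → M → ℝ}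
    (hf : ∀ x y, ContinuousOn (f x y) (U x ∩ U y))
    (hint : ∀ x y z, ∀ p ∈ U x ∩ U y ∩ U z,
      ∃ k : ℤ, f x y p + f y z p - f x z p = 2 * Real.pi * k) :
    ∃ m : Cech.Cocycle ℤ U, ∀ (s : Fin 3 → M) (p : U.inter s),
      twoPiZ (m.1 s p) = f (s 0) (s 1) p + f (s 1) (s 2) p - f (s 0) (s 2) p := by
  have hmem : ∀ (s : Fin 3 → M) (p : U.inter s) (i : Fin 3), (p : M) ∈ U (s i) := fun s p i =>
    Set.mem_iInter.1 p.2 i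
  choose k hk using fun (s : Fin 3 → M) (p : U.inter s) =>
    hint (s 0) (s 1) (s 2) p ⟨⟨hmem s p 0, hmem s p 1⟩, hmem s p 2⟩
  have hcont : ∀ s, IsLocallyConstant (k s) := fun s => by
    rw [IsLocallyConstant.iff_continuous, Int.isClosedEmbedding_coe_real.isInducing.continuous_iff]
    have hc : ∀ i j, Continuous fun p : U.inter s => f (s i) (s j) p := fun i j =>
      (hf (s i) (s j)).comp_continuous continuous_subtype_val
        fun p => ⟨hmem s p i, hmem s p j⟩
    have h : (fun p : U.inter s => (f (s 0) (s 1) p + f (s 1) (s 2) p - f (s 0) (s 2) p) /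
        (2 * Real.pi)) = Int.cast ∘ k s := by
      funext p
      rw [hk s p, Function.comp_apply, mul_div_cancel_left₀ _ (by positivity)]
    rw [← h]
    exact (((hc 0 1).add (hc 1 2)).sub (hc 0 2)).div_const _
  let m : Cech.Cochain U ℤ 2 := fun s => ⟨k s, hcont s⟩
  have hm : ∀ s p, twoPiZ (m s p) = f (s 0) (s 1) p + f (s 1) (s 2) p - f (s 0) (s 2) p :=
    fun s p => (hk s p).symm
  refine ⟨⟨m, ?_⟩, hm⟩
  have hinj : Function.Injective twoPiZ := fun a b h => by
    have h' : 2 * Real.pi * (a : ℝ) = 2 * Real.pi * b := h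
    exact_mod_cast mul_left_cancel₀ (by positivity) h'
  funext s
  ext p
  apply hinj
  have hsum : Cech.delta U ℤ 2 m s p = ∑ i : Fin 4, (-1 : ℤ) ^ (i : ℕ) •
      m (s ∘ i.succAbove) ⟨p, U.inter_comp s i.succAbove p.2⟩ := by
    rw [← LocallyConstant.coeFnAddMonoidHom_apply]
    simp only [Cech.delta, AddMonoidHom.coe_mk, ZeroHom.coe_mk, map_sum, map_zsmul,
      Finset.sum_apply, Pi.smul_apply]
    rfl
  rw [hsum, map_sum]
  simp only [map_zsmul, hm, Fin.sum_univ_four, Function.comp_apply]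
  have h12 : (1 : Fin 4).succAbove (2 : Fin 3) = 3 := rfl
  have h21 : (2 : Fin 4).succAbove (1 : Fin 3) = 1 := rfl
  have h22 : (2 : Fin 4).succAbove (2 : Fin 3) = 3 := rfl
  have h31 : (3 : Fin 4).succAbove (1 : Fin 3) = 1 := rfl
  have h32 : (3 : Fin 4).succAbove (2 : Fin 3) = 2 := rfl
  simp [h12, h21, h22, h31, h32]
  ring

end IntegerCocycle

/-! ### Integrality of the curvature class -/

theorem mainTheorem6 {n : ℕ} {M : Type*} [TopologicalSpace M] [T2Space M] [ParacompactSpace M]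
    [ChartedSpace (EuclideanSpace ℝ (Fin n)) M] [IsManifold (𝓡 n) ∞ M]
    {L : M → Type*} [∀ x, NormedAddCommGroup (L x)] [∀ x, InnerProductSpace ℂ (L x)]
    [TopologicalSpace (Bundle.TotalSpace ℂ L)] [FiberBundle ℂ L]
    [VectorBundle ℂ ℂ L] [VectorBundle ℝ ℂ L] [ContMDiffVectorBundle ∞ ℂ L (𝓡 n)]
    [IsSmoothHermitianBundle n L]
    (D : HermitianConnection n L) (e : ℝ) (he : e ≠ 0)
    (w : DiffForm n M 2 ℝ) (hw : w ∈ DiffForm.smoothForms n M 2)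
    (hcurv : D.HasCurvature (DiffForm.complexMul (Complex.I / e) w)) :
    ∃ h : e⁻¹ • w ∈ DiffForm.closedForms n M 2,
      IsIntegralClass (DiffForm.deRhamClass ⟨e⁻¹ • w, h⟩) := by
  choose σ V hxV hσ using fun x : M => exists_isUnitSection (n := n) (L := L) x
  have hclosed : e⁻¹ • w ∈ DiffForm.closedForms n M 2 :=
    ⟨Submodule.smul_mem _ _ hw, funext fun x =>
      HermitianConnection.d_smul_of_hasCurvature hcurv (hσ x) (hxV x)⟩
  let g : M → M → M → ℂ := fun i j p => inner ℂ (σ j p) (σ i p)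
  have hg : ∀ i j, ContMDiff (𝓡 n) 𝓘(ℝ, ℂ) ∞ (g i j) := fun i j => (hσ i).contMDiff_inner (hσ j)
  have hg1 : ∀ i j, ∀ p ∈ V i ∩ V j, ‖g i j p‖ = 1 := fun i j p hp => (hσ i).norm_inner (hσ j) hp
  -- On `U x` every transition function from `σ (c x)` to a section assigned to a `U y` that meets
  -- `U x` stays within distance `1` of its value at `x`, so it has a smooth argument there.
  obtain ⟨U, c, hUV, hU⟩ := PointedCover.exists_refinement V (fun i => (hσ i).isOpen)
    (Set.iUnion_eq_univ_iff.2 fun x => ⟨x, hxV x⟩)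
    (fun i j x => {p | ‖g i j p - g i j x‖ < 1})
    (fun i j x _ => by
      have h : Continuous fun p => ‖g i j p - g i j x‖ :=
        ((hg i j).continuous.sub continuous_const).norm
      exact (isOpen_lt h continuous_const).mem_nhds (by simp))
  have hslit : ∀ x y, ∀ p ∈ U x ∩ U y,
      g (c x) (c y) p / g (c x) (c y) x ∈ Complex.slitPlane := fun x y p hp => by
    obtain ⟨hx, hN⟩ := hU x y ⟨p, hp⟩
    exact Complex.div_mem_slitPlane_of_norm_sub_lt (hg1 _ _ x hx) (hN hp.1)
  let f : M → M → M → ℝ := fun x y p => Complex.argNear (g (c x) (c y) x) (g (c x) (c y) p)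
  have hexp : ∀ x y, ∀ p ∈ U x ∩ U y, Complex.exp (f x y p * Complex.I) = g (c x) (c y) p :=
    fun x y p hp => Complex.exp_argNear_mul_I (hg1 _ _ x (hU x y ⟨p, hp⟩).1)
      (hg1 _ _ p ⟨hUV x hp.1, hUV y hp.2⟩)
  have hfs : ∀ x y, ContMDiffOn (𝓡 n) 𝓘(ℝ, ℝ) ∞ (f x y) (U x ∩ U y) := fun x y p hp =>
    ((Complex.contDiffAt_argNear (hslit x y p hp)).contMDiffAt.comp p
      (hg (c x) (c y) p)).contMDiffWithinAt
  have hint : ∀ x y z, ∀ p ∈ U x ∩ U y ∩ U z,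
      ∃ k : ℤ, f x y p + f y z p - f x z p = 2 * Real.pi * k := by
    intro x y z p hp
    have hcoc : g (c x) (c y) p * g (c y) (c z) p = g (c x) (c z) p := by
      have h := inner_smul_self_of_norm_eq_one ((hσ (c y)).norm_eq_one p (hUV y hp.1.2))
        (σ (c x) p)
      change _ = inner ℂ (σ (c z) p) (σ (c x) p)
      rw [← h, inner_smul_right]
    have h : Complex.exp ((f x y p + f y z p : ℝ) * Complex.I) =
        Complex.exp (f x z p * Complex.I) := by
      rw [Complex.ofReal_add, add_mul, Complex.exp_add, hexp x y p hp.1,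
        hexp y z p ⟨hp.1.2, hp.2⟩, hexp x z p ⟨hp.1.1, hp.2⟩, hcoc]
    obtain ⟨k, hk⟩ := Complex.exp_eq_exp_iff_exists_int.1 h
    have := congrArg Complex.im hk
    refine ⟨k, ?_⟩
    simp only [Complex.mul_im, Complex.add_im, Complex.ofReal_re, Complex.ofReal_im, Complex.I_re,
      Complex.I_im, Complex.mul_re, Complex.intCast_re, Complex.intCast_im, Complex.re_ofNat,
      Complex.im_ofNat] at this
    linarith
  obtain ⟨m, hm⟩ := Cech.exists_integer_cocycle (fun x y => (hfs x y).continuousOn) hint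
  refine ⟨hclosed, ⟨e⁻¹ • w, hclosed⟩, Cech.classOf m, rfl, U, fun x => D.connForm (σ (c x)), f,
    Cech.cocycleMap (Cech.mapCoeff twoPiZ U) (Cech.delta_mapCoeff twoPiZ U) m,
    fun x => ⟨?_, fun p hp => HermitianConnection.d_connForm hcurv (hσ _) (hUV x hp)⟩,
    fun x y => ⟨hfs x y, fun p hp v =>
      HermitianConnection.mvfderiv_argNear_inner (hσ _) (hσ _) ⟨hUV x hp.1, hUV y hp.2⟩
        (hslit x y p hp) v⟩,
    fun x y z p => hm ![x, y, z] p, (Cech.H2map_classOf twoPiZ m).symm⟩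
  exact fun a => (HermitianConnection.smoothOn_connForm (hσ (c x)).contMDiff a).mono
    (Set.inter_subset_inter_right _ (Set.preimage_mono (Set.subset_univ _)))
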